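/- Let $\Omega\subset\mathbb{R}^3$ be a bounded convex domain. Let $(\mathcal{T}_i)_{i\in I}$ be a shape-regular, quasi-uniform family of triangulations with mesh sizes $h_i\in(0,1)$. That is, each $\mathcal{T}_i$ is a finite conforming (face-to-face) set of nondegenerate closed tetrahedra; the interior $\Omega_{h_i}$ of their union is contained in $\Omega$; and there are constants $\gamma,c,K>0$ such that, for every $i$, every $\tau\in\mathcal{T}_i$ contains a ball of radius $\gamma\operatorname{diam}\tau$ and satisfies $c\,h_i\le\operatorname{diam}\tau\le K\,h_i$. Write $h=h_i$, and let $V_h^0(\Omega_h)$ be the space of continuous functions that are affine on each tetrahedron of $\mathcal{T}_i$ and vanish on $\partial\Omega_h$, extended by zero outside $\Omega_h$. For each $i\in I$ and $z\in\Omega$ there is a unique discrete Green's function $G_h^z\in V_h^0(\Omega_h)$, that is, a function satisfying $$\int_{\Omega_h}\nabla G_h^z\cdot\nabla v_h\,dx=v_h(z)\qquad\text{for all } v_h\in V_h^0(\Omega_h),$$ and there exists a constant $C>0$, independent of $i$ (in particular of $h$), of $z$ and of $p$, such that $$\|\nabla G_h^z\|_{L^p(\Omega_h)}\le C\,h^{\frac3p-2}\qquad\text{for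 all } 2\le p\le\infty,$$ where $\frac3p=0$ for $p=\infty$. -/

import Mathlib

open MeasureTheory Set
open scoped ENNReal Gradient

noncomputable section

/-- Three-dimensional Euclidean space. -/
abbrev R3 : Type := EuclideanSpace ℝ (Fin 3)

/-- A (conforming) triangulation by tetrahedra: a geometric simplicial complex in `ℝ³` with
finitely many faces, each of which is a face of a tetrahedron of the complex. -/
structure IsTriangulation (T : Geometry.SimplicialComplex ℝ R3) : Prop where
  finite_faces : T.faces.Finite
  pure : ∀ s ∈ T.faces, ∃ t ∈ T.faces, s ⊆ t ∧ t.card = 4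

/-- The vertex sets of the tetrahedra of a triangulation; the tetrahedron itself is the
convex hull `convexHull ℝ (s : Set R3)`. -/
def tetrahedra (T : Geometry.SimplicialComplex ℝ R3) : Set (Finset R3) :=
  {s | s ∈ T.faces ∧ s.card = 4}

/-- The computational domain `Ω_h`: the open set whose closure is the union of the closed
tetrahedra. -/
def meshDomain (T : Geometry.SimplicialComplex ℝ R3) : Set R3 := interior T.space

/-- Shape regularity of a family of triangulations: every tetrahedron `τ` of every member
contains a ball of radius `γ * diam τ`, with `γ > 0` independent of `τ` and of the member. -/
def IsShapeRegularFamily {ι : Type*} (T : ι → Geometry.SimplicialComplex ℝ R3) : Prop :=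
  ∃ γ : ℝ, 0 < γ ∧ ∀ i, ∀ s ∈ tetrahedra (T i), ∃ x : R3,
    Metric.closedBall x (γ * Metric.diam (convexHull ℝ (s : Set R3))) ⊆
      convexHull ℝ (s : Set R3)

/-- Quasi-uniformity of a family of triangulations of sizes `h i`: the diameters of all
tetrahedra of `T i` are comparable to `h i`, uniformly in `i`. -/
def IsQuasiUniformFamily {ι : Type*} (T : ι → Geometry.SimplicialComplex ℝ R3) (h : ι → ℝ) :
    Prop :=
  ∃ c K : ℝ, 0 < c ∧ 0 < K ∧ ∀ i, ∀ s ∈ tetrahedra (T i),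
    c * h i ≤ Metric.diam (convexHull ℝ (s : Set R3)) ∧
      Metric.diam (convexHull ℝ (s : Set R3)) ≤ K * h i

/-- The finite element space `V_h⁰(Ω_h)` of continuous functions that are affine on each
tetrahedron and vanish on `∂Ω_h`. Its members are regarded as functions on `ℝ³` through their
(continuous) extension by zero outside `Ω_h`. -/
def femSpaceZero (T : Geometry.SimplicialComplex ℝ R3) : Submodule ℝ (R3 → ℝ) where
  carrier := {v | Continuous v ∧ (∀ x, x ∉ meshDomain T → v x = 0) ∧
    ∀ s ∈ tetrahedra T, ∃ f : R3 →ᵃ[ℝ] ℝ, EqOn v f (convexHull ℝ (s : Set R3))}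
  zero_mem' := ⟨continuous_const, fun _ _ => rfl, fun _ _ => ⟨0, fun _ _ => rfl⟩⟩
  add_mem' := by
    rintro u v ⟨hu, hu0, hua⟩ ⟨hv, hv0, hva⟩
    refine ⟨hu.add hv, fun x hx => by simp [hu0 x hx, hv0 x hx], fun s hs => ?_⟩
    obtain ⟨f, hf⟩ := hua s hs
    obtain ⟨g, hg⟩ := hva s hs
    exact ⟨f + g, fun x hx => by simp [hf hx, hg hx]⟩
  smul_mem' := by
    rintro a v ⟨hv, hv0, hva⟩
    refine ⟨hv.const_smul a, fun x hx => by simp [hv0 x hx], fun s hs => ?_⟩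
    obtain ⟨f, hf⟩ := hva s hs
    exact ⟨a • f, fun x hx => by simp [hf hx]⟩

/-- `G` is the discrete Green's function with singularity at `z`: `G ∈ V_h⁰(Ω_h)` and
`(∇G, ∇v)_{Ω_h} = v(z)` for all `v ∈ V_h⁰(Ω_h)`. Members of `V_h⁰(Ω_h)` are differentiable in
the interior of each tetrahedron, hence almost everywhere in `Ω_h`, and being Lipschitz they
have their pointwise gradient as weak gradient. -/
def IsDiscreteGreen (T : Geometry.SimplicialComplex ℝ R3) (z : R3) (G : R3 → ℝ) : Prop :=
  G ∈ femSpaceZero T ∧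
    ∀ v ∈ femSpaceZero T, ∫ x in meshDomain T, inner ℝ (∇ G x) (∇ v x) = v z

end

/-! Write `E` for the squared `L²` norm of `∇G`. Testing the defining identity with `G` itself gives
`E = G(z)`, so a discrete Sobolev inequality `|v(z)|² ≤ D E(v) / h` yields `E² ≤ D E / h`, hence `E
≤ D / h`. An inverse estimate bounds the square of the Lipschitz constant by `A E / h³ ≤ A D / h⁴`.
These are the cases `p = 2` and `p = ∞`; Hölder interpolation
(`eLpNorm_le_of_bound_of_lintegral_sq`) gives the rest with one constant. No elliptic regularity or
weighted norm enters.

The discrete Sobolev inequality rests on a continuous one, `exists_enorm_pow_three_le_of_lipschitz`: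
a `K`-Lipschitz compactly supported `v` on `ℝ³` satisfies `|v(z)|³ ≤ C K E(v)`. Squaring it and
inserting the inverse estimate for `K²` gives `|v(z)|⁶ ≤ C² A E³ / h³`. The continuous bound also
makes the Dirichlet form definite, which gives existence and uniqueness of `G`. -/

/-! ### Lipschitz functions: gluing, and derivatives on the zero set -/

open Filter Topology in
/-- A continuous function on a normed space that is `K`-Lipschitz on each member of a finite closed
cover is `K`-Lipschitz. -/
theorem lipschitzWith_of_finite_closed_cover {E : Type*} [NormedAddCommGroup E] [NormedSpace ℝ E]
    {v : E → ℝ} (hv : Continuous v) {S : Set (Set E)} (hS : S.Finite)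
    (hclosed : ∀ A ∈ S, IsClosed A) (hcover : ∀ x, ∃ A ∈ S, x ∈ A) {K : NNReal}
    (hlip : ∀ A ∈ S, LipschitzOnWith K v A) : LipschitzWith K v := by
  refine LipschitzWith.of_dist_le_mul fun y x => ?_
  set p : ℝ → E := fun t => x + t • (y - x) with hp
  have hpc : Continuous p := by fun_prop
  have hpd : ∀ s t : ℝ, dist (p s) (p t) = |s - t| * dist y x := by
    intro s t
    rw [dist_eq_norm, dist_eq_norm, hp]
    have : x + s • (y - x) - (x + t • (y - x)) = (s - t) • (y - x) := by
      rw [sub_smul]; abel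
    simp only [this, norm_smul, Real.norm_eq_abs]
  -- The comparison principle only needs the right slope bounded along some `s ↓ t`, not for all
  -- nearby `s`.
  have key := image_le_of_liminf_slope_right_le_deriv_boundary
    (f := fun t => |v (p t) - v x|) (a := 0) (b := 1)
    (B := fun t => K * dist y x * t) (B' := fun _ => K * dist y x)
  have hslope : ∀ t : ℝ, ∃ᶠ s in 𝓝[>] t, |v (p s) - v (p t)| ≤ K * dist y x * (s - t) := by
    intro t
    -- Pigeonhole: one of the finitely many sets is visited arbitrarily close to `t` from the right;
    -- being closed, it also contains `p t`.
    have hfreq : ∃ A ∈ S, ∃ᶠ s in 𝓝[>] t, p s ∈ A := by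
      by_contra! hcon
      have := (eventually_all_finite hS).2 fun A hA => hcon A hA
      obtain ⟨s, hs⟩ := this.exists
      obtain ⟨A, hA, hsA⟩ := hcover (p s)
      exact hs A hA hsA
    obtain ⟨A, hA, hfreq⟩ := hfreq
    have htA : p t ∈ A := by
      have hcl : IsClosed (p ⁻¹' A) := (hclosed A hA).preimage hpc
      refine hcl.mem_of_frequently_of_tendsto hfreq ?_
      exact tendsto_id.mono_left nhdsWithin_le_nhds
    refine (hfreq.and_eventually self_mem_nhdsWithin).mono fun s hs => ?_
    have h1 := (hlip A hA).dist_le_mul _ hs.1 _ htA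
    rw [hpd, abs_of_pos (sub_pos.2 hs.2), Real.dist_eq] at h1
    linarith
  have h1 := key (by fun_prop) (by simp [hp]) (by fun_prop) ?_ ?_ (right_mem_Icc.2 zero_le_one)
  · simpa [hp, Real.dist_eq] using h1
  · intro t _
    simpa using ((hasDerivAt_id t).const_mul (K * dist y x)).hasDerivWithinAt
  · intro t _ r hr
    refine ((hslope t).and_eventually self_mem_nhdsWithin).mono fun s ⟨h1, hs⟩ => ?_
    refine lt_of_le_of_lt ?_ hr
    rw [slope_def_field, div_le_iff₀ (sub_pos.2 hs)]
    refine le_trans (abs_sub_abs_le_abs_sub _ _) ?_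
    simpa using h1

/-- A real function is stationary at almost every zero. -/
theorem LipschitzWith.ae_fderiv_eq_zero_of_eq_zero {E : Type*} [NormedAddCommGroup E]
    [NormedSpace ℝ E] [FiniteDimensional ℝ E] [MeasurableSpace E] [BorelSpace E]
    {μ : Measure E} [μ.IsAddHaarMeasure] {v : E → ℝ} {K : NNReal} (hv : LipschitzWith K v) :
    ∀ᵐ x ∂μ, v x = 0 → fderiv ℝ v x = 0 := by
  -- Rademacher is applied to `|v|`, not `v`: a zero of `v` is a minimum of `|v|`, so where `|v|` is
  -- differentiable its derivative is zero, and `|v| = o` gives `v = o`.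
  have hn : LipschitzWith (1 * K) (fun x => ‖v x‖) := lipschitzWith_one_norm.comp hv
  filter_upwards [hn.ae_differentiableAt (μ := μ)] with x hx h0
  have hmin : IsLocalMin (fun x => ‖v x‖) x :=
    Filter.Eventually.of_forall fun y => by simp [h0]
  have hd := hx.hasFDerivAt
  rw [hmin.fderiv_eq_zero, hasFDerivAt_iff_isLittleO] at hd
  refine HasFDerivAt.fderiv ?_
  rw [hasFDerivAt_iff_isLittleO]
  simp only [h0, norm_zero, sub_zero, _root_.zero_apply] at hd ⊢
  exact hd.of_norm_left

/-! ### Pointwise bound by Lipschitz constant and Dirichlet energy -/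

/-- The squared `L²` norm of the derivative. -/
noncomputable def dirichletEnergy (v : R3 → ℝ) : ℝ≥0∞ := ∫⁻ x, ‖fderiv ℝ v x‖ₑ ^ 2

/-- On the ball of radius `|u z| / (2K)` about `z` one has `|u| ≥ |u z| / 2`, so the integral of
`|u|⁶` is at least a multiple of `|u z|⁹ / K³`. The Sobolev embedding into `L⁶` bounds it by a
multiple of `E³`; take cube roots. -/
theorem exists_enorm_pow_three_le_of_contDiff : ∃ C : NNReal, C ≠ 0 ∧ ∀ (u : R3 → ℝ) (K : NNReal),
    ContDiff ℝ 1 u → HasCompactSupport u → K ≠ 0 → LipschitzWith K u → ∀ z,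
      ‖u z‖ₑ ^ 3 ≤ C * K * dirichletEnergy u := by
  set S := SNormLESNormFDerivOfEqConst ℝ (volume : Measure R3) 2 with hS
  have hB0 : volume (Metric.ball (0 : R3) 1) ≠ 0 := (Metric.measure_ball_pos _ _ one_pos).ne'
  have hBt : volume (Metric.ball (0 : R3) 1) ≠ ⊤ := measure_ball_lt_top.ne
  obtain ⟨b, hb⟩ : ∃ b : NNReal, volume (Metric.ball (0 : R3) 1) = b :=
    ⟨_, (ENNReal.coe_toNNReal hBt).symm⟩
  have hb0 : b ≠ 0 := by rintro rfl; simp [hb] at hB0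
  -- The factor `2⁹` is `2⁶` from the height times `2³` from the radius; `S + 1` replaces `S` to
  -- keep `C` nonzero, which the case of infinite energy needs.
  obtain ⟨C, hC0, hC⟩ : ∃ C : NNReal, C ≠ 0 ∧ C ^ 3 * b = 2 ^ 9 * (S + 1) ^ 6 := by
    refine ⟨(2 ^ 9 * (S + 1) ^ 6 / b) ^ (3⁻¹ : ℝ), ?_, ?_⟩
    · simp [NNReal.rpow_eq_zero_iff, hb0]
    · rw [← NNReal.rpow_natCast, ← NNReal.rpow_mul]
      norm_num
      field_simp
  refine ⟨C, hC0, fun u K hu hcu hK hlip z => ?_⟩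
  have h6 : ∫⁻ x, ‖u x‖ₑ ^ 6 ≤ (S + 1 : NNReal) ^ 6 * dirichletEnergy u ^ 3 := by
    have := eLpNorm_le_eLpNorm_fderiv_of_eq (μ := (volume : Measure R3)) hu hcu (p := 2) (p' := 6)
      (by norm_num) (by simp) (by simp; norm_num)
    have h2 := ENNReal.rpow_le_rpow this (z := 6) (by norm_num)
    have e1 := eLpNorm_nnreal_pow_eq_lintegral (μ := (volume : Measure R3)) (f := u) (p := 6)
      (by norm_num)
    have e2 := eLpNorm_nnreal_pow_eq_lintegral (μ := (volume : Measure R3)) (f := fderiv ℝ u)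
      (p := 2) (by norm_num)
    have e3 : (eLpNorm (fderiv ℝ u) (2 : NNReal) volume) ^ (6 : ℝ) = dirichletEnergy u ^ 3 := by
      rw [dirichletEnergy, show (6 : ℝ) = ((2 : NNReal) : ℝ) * (3 : ℕ) by norm_num,
        ENNReal.rpow_mul, e2, ENNReal.rpow_natCast]
      simp
    rw [ENNReal.mul_rpow_of_nonneg _ _ (by norm_num), e3] at h2
    have e4 : eLpNorm u (6 : NNReal) volume ^ (6 : ℝ) = ∫⁻ x, ‖u x‖ₑ ^ 6 := by
      have : ((6 : NNReal) : ℝ) = (6 : ℕ) := by norm_num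
      rw [this] at e1
      simp only [ENNReal.rpow_natCast] at e1
      rw [← e1, ← ENNReal.rpow_natCast]; norm_num
    rw [e4] at h2
    refine h2.trans ?_
    gcongr
    rw [← ENNReal.rpow_natCast]
    push_cast
    gcongr
    simp [hS]
  have hball : ((‖u z‖₊ / 2 : NNReal) : ℝ≥0∞) ^ 6 * (((‖u z‖₊ / (2 * K) : NNReal) : ℝ≥0∞) ^ 3 * b)
      ≤ ∫⁻ x, ‖u x‖ₑ ^ 6 := by
    have hvol : volume (Metric.ball z (‖u z‖ / (2 * K))) =
        ((‖u z‖₊ / (2 * K) : NNReal) : ℝ≥0∞) ^ 3 * b := by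
      rw [Measure.addHaar_ball _ _ (by positivity), ← hb, ENNReal.ofReal_pow (by positivity)]
      simp only [finrank_euclideanSpace, Fintype.card_fin]
      congr 2
      rw [ENNReal.ofReal, ENNReal.coe_inj]
      ext
      simp [div_nonneg]
    rw [← hvol, ← setLIntegral_const]
    refine le_trans ?_ (setLIntegral_le_lintegral (Metric.ball z (‖u z‖ / (2 * K))) _)
    refine setLIntegral_mono' measurableSet_ball fun x hx => ?_
    gcongr
    rw [enorm_eq_nnnorm, ENNReal.coe_le_coe, ← NNReal.coe_le_coe]
    push_cast
    have h1 := hlip.dist_le_mul x z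
    have h2 : (K : ℝ) * dist x z ≤ ‖u z‖ / 2 := by
      have h3 : dist x z ≤ ‖u z‖ / (2 * K) := (Metric.mem_ball.1 hx).le
      calc (K : ℝ) * dist x z ≤ K * (‖u z‖ / (2 * K)) := by gcongr
        _ = ‖u z‖ / 2 := by field_simp
    rw [dist_eq_norm] at h1
    have h4 := norm_sub_norm_le (u z) (u x)
    rw [norm_sub_rev] at h4
    linarith
  have hmain := hball.trans h6
  rcases eq_or_ne (dirichletEnergy u) ⊤ with htop | htop
  · rw [htop, ENNReal.mul_top (by simp [hC0, hK])]; exact le_top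
  · lift dirichletEnergy u to NNReal using htop with e
    rw [enorm_eq_nnnorm]
    norm_cast at hmain ⊢
    set m := ‖u z‖₊
    have h9 : (m ^ 3) ^ 3 ≤ (C * K * e) ^ 3 := by
      have : (m / 2) ^ 6 * ((m / (2 * K)) ^ 3 * b) = (m ^ 3) ^ 3 * b / (2 ^ 9 * K ^ 3) := by
        field_simp
      rw [this, div_le_iff₀ (by positivity)] at hmain
      have hbp : 0 < b := pos_iff_ne_zero.2 hb0
      refine le_of_mul_le_mul_right (hmain.trans_eq ?_) hbp
      calc (S + 1) ^ 6 * e ^ 3 * (2 ^ 9 * K ^ 3) = (2 ^ 9 * (S + 1) ^ 6) * (K ^ 3 * e ^ 3) := by ring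
        _ = _ := by rw [← hC]; ring
    exact (pow_le_pow_iff_left₀ (by positivity) (by positivity) (by norm_num)).1 h9

-- Difference quotients are dominated by `φ t * K`, and Rademacher gives differentiability of `v` at
-- `x - t` for almost every `t`, so one may differentiate under the integral.
open scoped Convolution in
theorem hasFDerivAt_convolution_of_lipschitz {φ v : R3 → ℝ} (hφc : Continuous φ)
    (hφs : HasCompactSupport φ) (hφ0 : ∀ t, 0 ≤ φ t) {K : NNReal} (hv : LipschitzWith K v) (x : R3) :
    HasFDerivAt (φ ⋆[ContinuousLinearMap.lsmul ℝ ℝ] v) (∫ t, φ t • fderiv ℝ v (x - t)) x := by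
  have hvc := hv.continuous
  have hint : Integrable φ := hφc.integrable_of_hasCompactSupport hφs
  have hmf : Measurable (fderiv ℝ v) := measurable_fderiv ℝ v
  refine (hasFDerivAt_integral_of_dominated_loc_of_lip' (F := fun x t => φ t • v (x - t))
    (bound := fun t => φ t * K) Filter.univ_mem ?_ ?_ ?_ ?_ (hint.mul_const _) ?_).2
  · intro y _
    exact Continuous.aestronglyMeasurable (by fun_prop)
  · exact Continuous.integrable_of_hasCompactSupport (by fun_prop) hφs.smul_right
  · exact (hφc.measurable.smul (hmf.comp (by fun_prop))).aestronglyMeasurable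
  · refine Filter.Eventually.of_forall fun t y _ => ?_
    have := hv.dist_le_mul (y - t) (x - t)
    rw [dist_eq_norm, dist_eq_norm, sub_sub_sub_cancel_right] at this
    rw [← smul_sub, norm_smul, Real.norm_of_nonneg (hφ0 t), mul_assoc]
    exact mul_le_mul_of_nonneg_left this (hφ0 t)
  · have hq : Measure.QuasiMeasurePreserving (fun t : R3 => x - t) volume volume :=
      (Measure.measurePreserving_sub_left volume x).quasiMeasurePreserving
    filter_upwards [hq.ae (hv.ae_differentiableAt (μ := volume))] with t ht
    have h1 : HasFDerivAt (fun y => v (y - t)) (fderiv ℝ v (x - t)) x := by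
      exact ht.hasFDerivAt.comp x ((hasFDerivAt_id x).sub_const t)
    exact h1.const_smul (φ t)

open scoped Convolution in
theorem lipschitzWith_convolution {φ v : R3 → ℝ} (hφc : Continuous φ)
    (hφs : HasCompactSupport φ) (hφ0 : ∀ t, 0 ≤ φ t) (hφ1 : ∫ t, φ t = 1) {K : NNReal}
    (hv : LipschitzWith K v) : LipschitzWith K (φ ⋆[ContinuousLinearMap.lsmul ℝ ℝ] v) := by
  have hvc := hv.continuous
  have hint : Integrable φ := hφc.integrable_of_hasCompactSupport hφs
  refine lipschitzWith_of_nnnorm_fderiv_le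
    (fun x => (hasFDerivAt_convolution_of_lipschitz hφc hφs hφ0 hv x).differentiableAt) fun x => ?_
  rw [(hasFDerivAt_convolution_of_lipschitz hφc hφs hφ0 hv x).fderiv, ← NNReal.coe_le_coe,
    coe_nnnorm]
  refine (norm_integral_le_of_norm_le (hint.mul_const (K : ℝ)) (.of_forall fun t => ?_)).trans_eq ?_
  · rw [norm_smul, Real.norm_of_nonneg (hφ0 t)]
    exact mul_le_mul_of_nonneg_left (norm_fderiv_le_of_lipschitz ℝ hv) (hφ0 t)
  · rw [integral_mul_const, hφ1, one_mul]

theorem lintegral_sq_le_of_isProbabilityMeasure {α : Type*} [MeasurableSpace α] {ν : Measure α}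
    [IsProbabilityMeasure ν] {g : α → ℝ≥0∞} (hg : AEMeasurable g ν) :
    (∫⁻ t, g t ∂ν) ^ 2 ≤ ∫⁻ t, g t ^ 2 ∂ν := by
  have h := ENNReal.lintegral_mul_le_Lp_mul_Lq ν Real.HolderConjugate.two_two hg
    (aemeasurable_const (b := (1 : ℝ≥0∞)))
  have h2 := ENNReal.rpow_le_rpow h (z := 2) (by norm_num)
  simp only [Pi.mul_apply, mul_one, ENNReal.one_rpow, lintegral_const, measure_univ] at h2
  rw [← ENNReal.rpow_mul] at h2
  simpa using h2

-- Jensen's inequality for the probability measure `φ dt`, then Tonelli and translation invariance.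
open scoped Convolution in
theorem dirichletEnergy_convolution_le {φ v : R3 → ℝ} (hφc : Continuous φ)
    (hφs : HasCompactSupport φ) (hφ0 : ∀ t, 0 ≤ φ t) (hφ1 : ∫ t, φ t = 1) {K : NNReal}
    (hv : LipschitzWith K v) :
    dirichletEnergy (φ ⋆[ContinuousLinearMap.lsmul ℝ ℝ] v) ≤ dirichletEnergy v := by
  have hint : Integrable φ := hφc.integrable_of_hasCompactSupport hφs
  set ν : Measure R3 := volume.withDensity (fun t => ‖φ t‖ₑ) with hν
  have hφm : Measurable (fun t => ‖φ t‖ₑ) := hφc.measurable.enorm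
  have hmf : Measurable (fun x => ‖fderiv ℝ v x‖ₑ) := (measurable_fderiv ℝ v).enorm
  have hprob : IsProbabilityMeasure ν := ⟨by
    rw [hν, withDensity_apply _ MeasurableSet.univ, Measure.restrict_univ,
      ← ofReal_integral_norm_eq_lintegral_enorm hint]
    simp_rw [Real.norm_of_nonneg (hφ0 _)]
    simp [hφ1]⟩
  have hpt : ∀ x, ‖fderiv ℝ (φ ⋆[ContinuousLinearMap.lsmul ℝ ℝ] v) x‖ₑ ^ 2 ≤
      ∫⁻ t, ‖fderiv ℝ v (x - t)‖ₑ ^ 2 ∂ν := by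
    intro x
    rw [(hasFDerivAt_convolution_of_lipschitz hφc hφs hφ0 hv x).fderiv]
    have hm : Measurable (fun t => ‖fderiv ℝ v (x - t)‖ₑ) := hmf.comp (by fun_prop)
    refine le_trans ?_ (lintegral_sq_le_of_isProbabilityMeasure hm.aemeasurable)
    gcongr
    refine (enorm_integral_le_lintegral_enorm _).trans_eq ?_
    rw [hν, lintegral_withDensity_eq_lintegral_mul _ hφm hm]
    simp [enorm_smul]
  calc dirichletEnergy (φ ⋆[ContinuousLinearMap.lsmul ℝ ℝ] v)
      ≤ ∫⁻ x, ∫⁻ t, ‖fderiv ℝ v (x - t)‖ₑ ^ 2 ∂ν := lintegral_mono hpt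
    _ = ∫⁻ t, (∫⁻ x, ‖fderiv ℝ v (x - t)‖ₑ ^ 2) ∂ν := by
        refine lintegral_lintegral_swap (Measurable.aemeasurable ?_)
        exact (hmf.comp (by fun_prop : Measurable fun q : R3 × R3 => q.1 - q.2)).pow_const 2
    _ = ∫⁻ _, dirichletEnergy v ∂ν := by
        refine lintegral_congr fun t => ?_
        exact lintegral_sub_right_eq_self (fun x => ‖fderiv ℝ v x‖ₑ ^ 2) t
    _ = dirichletEnergy v := by simp

open scoped Convolution in
/-- For a compactly supported Lipschitz function on `ℝ³`, the cube of the supremum is controlled by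
the Lipschitz constant times the Dirichlet energy. -/
theorem exists_enorm_pow_three_le_of_lipschitz : ∃ C : NNReal, ∀ (v : R3 → ℝ) (K : NNReal),
    HasCompactSupport v → LipschitzWith K v → ∀ z, ‖v z‖ₑ ^ 3 ≤ C * K * dirichletEnergy v := by
  obtain ⟨C, hC0, hC⟩ := exists_enorm_pow_three_le_of_contDiff
  refine ⟨C, fun v K hvs hv z => ?_⟩
  rcases eq_or_ne K 0 with rfl | hK
  -- For `K = 0` the function is constant, and compact support in a noncompact space forces the
  -- constant to be zero.
  · obtain ⟨x, hx⟩ : ∃ x, v x = 0 := by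
      by_contra! h
      have : Function.support v = univ := Set.eq_univ_of_forall h
      have h2 := hvs.isCompact
      rw [tsupport, this, closure_univ] at h2
      exact noncompact_univ R3 h2
    have := hv.dist_le_mul z x
    have hz : v z = 0 := by simpa [hx] using this
    simp [hz]
  · let φ : ℕ → ContDiffBump (0 : R3) := fun n =>
      ⟨1 / (n + 2), 1 / (n + 1), by positivity,
        one_div_lt_one_div_of_lt (by positivity) (by linarith)⟩
    have hlim := ContDiffBump.convolution_tendsto_right_of_continuous (μ := volume) (φ := φ)
      (l := Filter.atTop) tendsto_one_div_add_atTop_nhds_zero_nat hv.continuous z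
    refine le_of_tendsto ((ENNReal.continuous_pow 3).tendsto _ |>.comp
      ((continuous_enorm.tendsto _).comp hlim)) (.of_forall fun n => ?_)
    have hφc := (φ n).continuous_normed (μ := volume)
    have hφs := (φ n).hasCompactSupport_normed (μ := volume)
    have hφ0 := (φ n).nonneg_normed (μ := volume)
    have hφ1 := (φ n).integral_normed (μ := volume)
    refine (hC _ K ?_ (hφs.convolution _ hvs) hK
      (lipschitzWith_convolution hφc hφs hφ0 hφ1 hv) z).trans ?_
    · exact hφs.contDiff_convolution_left _ (φ n).contDiff_normed
        hv.continuous.locallyIntegrable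
    · gcongr
      exact dirichletEnergy_convolution_le hφc hφs hφ0 hφ1 hv

/-! ### Gradients and Fréchet derivatives -/

theorem enorm_gradient (v : R3 → ℝ) (x : R3) : ‖∇ v x‖ₑ = ‖fderiv ℝ v x‖ₑ := by
  rw [gradient, LinearIsometryEquiv.enorm_map]

theorem norm_gradient_le {v : R3 → ℝ} {K : NNReal} (hv : LipschitzWith K v) (x : R3) :
    ‖∇ v x‖ ≤ K := by
  rw [gradient, LinearIsometryEquiv.norm_map]
  exact norm_fderiv_le_of_lipschitz ℝ hv

theorem measurable_gradient (v : R3 → ℝ) : Measurable (∇ v) :=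
  (InnerProductSpace.toDual ℝ R3).symm.continuous.measurable.comp (measurable_fderiv ℝ v)

theorem gradient_add {u v : R3 → ℝ} {x : R3} (hu : DifferentiableAt ℝ u x)
    (hv : DifferentiableAt ℝ v x) : ∇ (u + v) x = ∇ u x + ∇ v x := by
  rw [gradient, fderiv_add hu hv, map_add]; rfl

theorem gradient_smul {v : R3 → ℝ} {x : R3} (a : ℝ) (hv : DifferentiableAt ℝ v x) :
    ∇ (a • v) x = a • ∇ v x := by
  rw [gradient, fderiv_const_smul hv, map_smulₛₗ]; rfl

/-! ### The finite element space on one mesh -/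

section Mesh

variable {T : Geometry.SimplicialComplex ℝ R3}

theorem finite_tetrahedra (hT : IsTriangulation T) : (tetrahedra T).Finite :=
  hT.finite_faces.subset fun _ hs => hs.1

theorem isCompact_space (hT : IsTriangulation T) : IsCompact T.space :=
  hT.finite_faces.isCompact_biUnion fun s _ => s.finite_toSet.isCompact_convexHull ℝ

theorem meshDomain_subset_space : meshDomain T ⊆ T.space := interior_subset

theorem exists_tetrahedron_mem (hT : IsTriangulation T) {x : R3} (hx : x ∈ T.space) :
    ∃ s ∈ tetrahedra T, x ∈ convexHull ℝ (s : Set R3) := by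
  obtain ⟨s, hs, hxs⟩ := Geometry.SimplicialComplex.mem_space_iff.1 hx
  obtain ⟨t, ht, hst, ht4⟩ := hT.pure s hs
  exact ⟨t, ⟨ht, ht4⟩, convexHull_mono (by exact_mod_cast hst) hxs⟩

theorem volume_meshDomain_lt_top (hT : IsTriangulation T) : volume (meshDomain T) < ⊤ :=
  (measure_mono meshDomain_subset_space).trans_lt (isCompact_space hT).measure_lt_top

theorem hasCompactSupport_of_mem_femSpaceZero (hT : IsTriangulation T) {v : R3 → ℝ}
    (hv : v ∈ femSpaceZero T) : HasCompactSupport v :=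
  HasCompactSupport.intro (isCompact_space hT) fun x hx =>
    hv.2.1 x fun h => hx (meshDomain_subset_space h)

/-- The tetrahedra and the complement of `Ω_h`, where `v` vanishes, form a finite closed cover of
`ℝ³`; the shape of `Ω_h` does not affect the constant. -/
theorem lipschitzWith_of_lipschitzOnWith_tetrahedra (hT : IsTriangulation T) {v : R3 → ℝ}
    (hv : v ∈ femSpaceZero T) {K : NNReal}
    (h : ∀ s ∈ tetrahedra T, LipschitzOnWith K v (convexHull ℝ (s : Set R3))) :
    LipschitzWith K v := by
  refine lipschitzWith_of_finite_closed_cover hv.1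
    (S := insert (meshDomain T)ᶜ ((fun s : Finset R3 => convexHull ℝ (s : Set R3)) '' tetrahedra T))
    (((finite_tetrahedra hT).image _).insert _) ?_ ?_ ?_
  · rintro A (rfl | ⟨s, -, rfl⟩)
    · exact isOpen_interior.isClosed_compl
    · exact s.finite_toSet.isClosed_convexHull ℝ
  · intro x
    by_cases hx : x ∈ meshDomain T
    · obtain ⟨s, hs, hxs⟩ := exists_tetrahedron_mem hT (meshDomain_subset_space hx)
      exact ⟨_, Or.inr ⟨s, hs, rfl⟩, hxs⟩
    · exact ⟨_, Or.inl rfl, hx⟩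
  · rintro A (rfl | ⟨s, hs, rfl⟩)
    · intro x hx y hy
      simp [hv.2.1 x hx, hv.2.1 y hy]
    · exact h s hs

theorem AffineMap.lipschitzWith_linear (f : R3 →ᵃ[ℝ] ℝ) :
    LipschitzWith ‖LinearMap.toContinuousLinearMap f.linear‖₊ f := by
  refine LipschitzWith.of_dist_le_mul fun x y => ?_
  rw [dist_eq_norm, dist_eq_norm, ← vsub_eq_sub (f x), ← f.linearMap_vsub]
  exact (LinearMap.toContinuousLinearMap f.linear).le_opNorm (x - y)

theorem AffineMap.hasFDerivAt_linear (f : R3 →ᵃ[ℝ] ℝ) (x : R3) :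
    HasFDerivAt f (LinearMap.toContinuousLinearMap f.linear) x := by
  rw [f.decomp]
  exact ((LinearMap.toContinuousLinearMap f.linear).hasFDerivAt (x := x)).add_const (f 0)

theorem exists_lipschitzWith_of_mem_femSpaceZero (hT : IsTriangulation T) {v : R3 → ℝ}
    (hv : v ∈ femSpaceZero T) : ∃ K, LipschitzWith K v := by
  choose! f hf using hv.2.2
  obtain ⟨K, hK⟩ := ((finite_tetrahedra hT).image
    fun s => ‖LinearMap.toContinuousLinearMap (f s).linear‖₊).bddAbove
  refine ⟨K, lipschitzWith_of_lipschitzOnWith_tetrahedra hT hv fun s hs => ?_⟩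
  intro x hx y hy
  rw [hf s hs hx, hf s hs hy]
  exact (f s).lipschitzWith_linear.weaken (hK ⟨s, hs, rfl⟩) x y

theorem ae_differentiableAt_of_mem_femSpaceZero (hT : IsTriangulation T) {v : R3 → ℝ}
    (hv : v ∈ femSpaceZero T) (A : Set R3) :
    ∀ᵐ x ∂volume.restrict A, DifferentiableAt ℝ v x :=
  let ⟨_, hK⟩ := exists_lipschitzWith_of_mem_femSpaceZero hT hv
  ae_restrict_of_ae hK.ae_differentiableAt

/-- Off `Ω_h` the function is zero, hence stationary almost everywhere there; no null-boundary
argument is needed. -/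
theorem dirichletEnergy_eq_setLIntegral (hT : IsTriangulation T) {v : R3 → ℝ}
    (hv : v ∈ femSpaceZero T) :
    dirichletEnergy v = ∫⁻ x in meshDomain T, ‖∇ v x‖ₑ ^ 2 := by
  obtain ⟨K, hK⟩ := exists_lipschitzWith_of_mem_femSpaceZero hT hv
  simp_rw [enorm_gradient]
  have hm : MeasurableSet (meshDomain T) := isOpen_interior.measurableSet
  rw [dirichletEnergy, ← lintegral_add_compl _ hm]
  convert add_zero _
  rw [setLIntegral_congr_fun_ae (g := 0) hm.compl]
  · simp
  · filter_upwards [hK.ae_fderiv_eq_zero_of_eq_zero (μ := volume)] with x hx hxm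
    rw [hx (hv.2.1 x hxm), enorm_eq_nnnorm, nnnorm_zero]
    simp

theorem integrable_inner_gradient (hT : IsTriangulation T) {u v : R3 → ℝ}
    (hu : u ∈ femSpaceZero T) (hv : v ∈ femSpaceZero T) :
    Integrable (fun x => inner ℝ (∇ u x) (∇ v x)) (volume.restrict (meshDomain T)) := by
  obtain ⟨K, hK⟩ := exists_lipschitzWith_of_mem_femSpaceZero hT hu
  obtain ⟨L, hL⟩ := exists_lipschitzWith_of_mem_femSpaceZero hT hv
  have : IsFiniteMeasure (volume.restrict (meshDomain T)) :=
    ⟨by simpa using volume_meshDomain_lt_top hT⟩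
  refine Integrable.of_bound
    ((measurable_gradient u).inner (measurable_gradient v)).aestronglyMeasurable (K * L)
    (.of_forall fun x => ?_)
  exact (norm_inner_le_norm _ _).trans
    (mul_le_mul (norm_gradient_le hK x) (norm_gradient_le hL x) (norm_nonneg _) K.2)

theorem dirichletEnergy_eq_ofReal (hT : IsTriangulation T) {v : R3 → ℝ} (hv : v ∈ femSpaceZero T) :
    dirichletEnergy v = ENNReal.ofReal (∫ x in meshDomain T, inner ℝ (∇ v x) (∇ v x)) := by
  rw [dirichletEnergy_eq_setLIntegral hT hv, ofReal_integral_eq_lintegral_ofReal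
    (integrable_inner_gradient hT hv hv) (.of_forall fun x => real_inner_self_nonneg)]
  refine lintegral_congr fun x => ?_
  rw [real_inner_self_eq_norm_sq, ENNReal.ofReal_pow (norm_nonneg _), ofReal_norm]

/-- The Dirichlet form on the finite element space. -/
noncomputable def dirichletForm (hT : IsTriangulation T) :
    femSpaceZero T →ₗ[ℝ] femSpaceZero T →ₗ[ℝ] ℝ :=
  LinearMap.mk₂ ℝ (fun u v => ∫ x in meshDomain T, inner ℝ (∇ u.1 x) (∇ v.1 x))
    (fun u v w => by
      rw [← integral_add (integrable_inner_gradient hT u.2 w.2)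
        (integrable_inner_gradient hT v.2 w.2)]
      refine integral_congr_ae ?_
      filter_upwards [ae_differentiableAt_of_mem_femSpaceZero hT u.2 _,
        ae_differentiableAt_of_mem_femSpaceZero hT v.2 _]
        with x hu hv
      rw [Submodule.coe_add, gradient_add hu hv, inner_add_left])
    (fun a u w => by
      rw [smul_eq_mul, ← integral_const_mul]
      refine integral_congr_ae ?_
      filter_upwards [ae_differentiableAt_of_mem_femSpaceZero hT u.2 _]
        with x hu
      rw [Submodule.coe_smul, gradient_smul a hu, real_inner_smul_left])
    (fun w u v => by
      rw [← integral_add (integrable_inner_gradient hT w.2 u.2)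
        (integrable_inner_gradient hT w.2 v.2)]
      refine integral_congr_ae ?_
      filter_upwards [ae_differentiableAt_of_mem_femSpaceZero hT u.2 _,
        ae_differentiableAt_of_mem_femSpaceZero hT v.2 _]
        with x hu hv
      rw [Submodule.coe_add, gradient_add hu hv, inner_add_right])
    (fun a w u => by
      rw [smul_eq_mul, ← integral_const_mul]
      refine integral_congr_ae ?_
      filter_upwards [ae_differentiableAt_of_mem_femSpaceZero hT u.2 _]
        with x hu
      rw [Submodule.coe_smul, gradient_smul a hu, real_inner_smul_right])

theorem dirichletForm_apply (hT : IsTriangulation T) (u v : femSpaceZero T) :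
    dirichletForm hT u v = ∫ x in meshDomain T, inner ℝ (∇ u.1 x) (∇ v.1 x) := rfl

theorem eq_zero_of_eq_zero_on_vertices (hT : IsTriangulation T) {v : R3 → ℝ}
    (hv : v ∈ femSpaceZero T) (h0 : ∀ s ∈ tetrahedra T, ∀ x ∈ s, v x = 0) : v = 0 := by
  funext x
  by_cases hx : x ∈ meshDomain T
  · obtain ⟨s, hs, hxs⟩ := exists_tetrahedron_mem hT (meshDomain_subset_space hx)
    obtain ⟨f, hf⟩ := hv.2.2 s hs
    have hconv : Convex ℝ (f ⁻¹' {0}) := (convex_singleton 0).affine_preimage f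
    have hsub : (s : Set R3) ⊆ f ⁻¹' {0} := fun y hy => by
      rw [mem_preimage, mem_singleton_iff, ← hf (subset_convexHull ℝ _ hy)]
      exact h0 s hs y hy
    rw [hf hxs]
    exact convexHull_min hsub hconv hxs
  · exact hv.2.1 x hx

theorem finiteDimensional_femSpaceZero (hT : IsTriangulation T) :
    FiniteDimensional ℝ (femSpaceZero T) := by
  have hfin : (⋃ s ∈ tetrahedra T, (s : Set R3)).Finite :=
    (finite_tetrahedra hT).biUnion fun s _ => s.finite_toSet
  have := hfin.to_subtype
  let R : femSpaceZero T →ₗ[ℝ] ((⋃ s ∈ tetrahedra T, (s : Set R3) : Set R3) → ℝ) :=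
    { toFun := fun v x => v.1 x
      map_add' := fun _ _ => rfl
      map_smul' := fun _ _ => rfl }
  refine FiniteDimensional.of_injective R ((injective_iff_map_eq_zero R).2 fun v hv => ?_)
  refine Subtype.ext (eq_zero_of_eq_zero_on_vertices hT v.2 fun s hs x hx => ?_)
  exact congrFun hv ⟨x, mem_biUnion hs hx⟩

/-- The pointwise bound by the energy plays the role of Poincaré's inequality. -/
theorem eq_zero_of_dirichletForm_self_eq_zero (hT : IsTriangulation T) {v : femSpaceZero T}
    (h : dirichletForm hT v v = 0) : v = 0 := by
  obtain ⟨C, hC⟩ := exists_enorm_pow_three_le_of_lipschitz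
  obtain ⟨K, hK⟩ := exists_lipschitzWith_of_mem_femSpaceZero hT v.2
  refine Subtype.ext (funext fun z => ?_)
  have := hC v.1 K (hasCompactSupport_of_mem_femSpaceZero hT v.2) hK z
  rw [dirichletEnergy_eq_ofReal hT v.2, ← dirichletForm_apply hT v v, h] at this
  simpa using this

/-- A definite form on a finite-dimensional space identifies it with its dual; `G` represents
evaluation at `z`. -/
theorem existsUnique_isDiscreteGreen (hT : IsTriangulation T) (z : R3) :
    ∃! G : R3 → ℝ, IsDiscreteGreen T z G := by
  have := finiteDimensional_femSpaceZero hT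
  have hinj : Function.Injective (dirichletForm hT) :=
    (injective_iff_map_eq_zero _).2 fun v hv =>
      eq_zero_of_dirichletForm_self_eq_zero hT (by rw [hv, LinearMap.zero_apply])
  have hsurj : Function.Surjective (dirichletForm hT) :=
    (LinearMap.injective_iff_surjective_of_finrank_eq_finrank
      (Subspace.dual_finrank_eq (K := ℝ) (V := femSpaceZero T)).symm).1 hinj
  let ev : femSpaceZero T →ₗ[ℝ] ℝ := (LinearMap.proj z).comp (femSpaceZero T).subtype
  obtain ⟨G, hG⟩ := hsurj ev
  refine ⟨G.1, ⟨G.2, fun v hv => LinearMap.congr_fun hG ⟨v, hv⟩⟩, fun G' hG' => ?_⟩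
  have : dirichletForm hT ⟨G', hG'.1⟩ = dirichletForm hT G := by
    rw [hG]
    exact LinearMap.ext fun v => hG'.2 v.1 v.2
  exact congrArg Subtype.val (hinj this)

theorem enorm_sq_mul_volume_ball_le_dirichletEnergy {v : R3 → ℝ} {f : R3 →ᵃ[ℝ] ℝ} {x : R3} {r : ℝ}
    (h : EqOn v f (Metric.ball x r)) :
    ‖LinearMap.toContinuousLinearMap f.linear‖ₑ ^ 2 * volume (Metric.ball x r) ≤
      dirichletEnergy v := by
  rw [← setLIntegral_const]
  refine le_trans (setLIntegral_mono' measurableSet_ball fun y hy => ?_)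
    (setLIntegral_le_lintegral (Metric.ball x r) _)
  have : v =ᶠ[nhds y] f := h.eventuallyEq_of_mem (Metric.isOpen_ball.mem_nhds hy)
  rw [this.fderiv_eq, (f.hasFDerivAt_linear y).fderiv]

end Mesh

/-! ### Estimates uniform over the mesh family -/

theorem dirichletEnergy_eq_coe {T : Geometry.SimplicialComplex ℝ R3} (hT : IsTriangulation T)
    {v : R3 → ℝ} (hv : v ∈ femSpaceZero T) :
    dirichletEnergy v = (dirichletEnergy v).toNNReal :=
  (ENNReal.coe_toNNReal (by rw [dirichletEnergy_eq_ofReal hT hv]; exact ENNReal.ofReal_ne_top)).symm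

/-- Inverse estimate: on a shape-regular quasi-uniform family of meshes, the Lipschitz constant of a
finite element function is bounded by `h ^ (-3 / 2)` times the `L²` norm of its gradient. -/
theorem exists_lipschitzWith_sq_le {ι : Type*} {T : ι → Geometry.SimplicialComplex ℝ R3} {h : ι → ℝ}
    (hh : ∀ i, 0 < h i) (hT : ∀ i, IsTriangulation (T i)) (hshape : IsShapeRegularFamily T)
    (hquasi : IsQuasiUniformFamily T h) : ∃ A : NNReal, ∀ i, ∀ v ∈ femSpaceZero (T i),
      ∃ K, LipschitzWith K v ∧
        K ^ 2 = A * (dirichletEnergy v).toNNReal / (h i).toNNReal ^ 3 := by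
  obtain ⟨γ, hγ, hγT⟩ := hshape
  obtain ⟨c, _, hc, -, hcT⟩ := hquasi
  have hBt : volume (Metric.ball (0 : R3) 1) ≠ ⊤ := measure_ball_lt_top.ne
  have hB0 : volume (Metric.ball (0 : R3) 1) ≠ 0 := (Metric.measure_ball_pos _ _ one_pos).ne'
  obtain ⟨b, hb⟩ : ∃ b : NNReal, volume (Metric.ball (0 : R3) 1) = b :=
    ⟨_, (ENNReal.coe_toNNReal hBt).symm⟩
  have hb0 : 0 < b := pos_iff_ne_zero.2 (by rintro rfl; simp [hb] at hB0)
  -- Every tetrahedron of mesh `i` contains a ball of radius `a * h i`. The gradient is constant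
  -- there, so its square times `(a h)³ b` is at most the energy.
  set a : NNReal := (γ * c).toNNReal with ha
  have ha0 : 0 < a := Real.toNNReal_pos.2 (by positivity)
  refine ⟨1 / (a ^ 3 * b), fun i v hv => ?_⟩
  have hh0 : 0 < (h i).toNNReal := Real.toNNReal_pos.2 (hh i)
  refine ⟨NNReal.sqrt (1 / (a ^ 3 * b) * (dirichletEnergy v).toNNReal / (h i).toNNReal ^ 3), ?_,
    NNReal.sq_sqrt _⟩
  refine lipschitzWith_of_lipschitzOnWith_tetrahedra (hT i) hv fun s hs => ?_
  obtain ⟨f, hf⟩ := hv.2.2 s hs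
  obtain ⟨x, hx⟩ := hγT i s hs
  have hsub : Metric.ball x (γ * c * h i) ⊆ convexHull ℝ (s : Set R3) := by
    refine (Metric.ball_subset_closedBall.trans (Metric.closedBall_subset_closedBall ?_)).trans hx
    rw [mul_assoc]
    exact mul_le_mul_of_nonneg_left (hcT i s hs).1 hγ.le
  have hE := enorm_sq_mul_volume_ball_le_dirichletEnergy (hf.mono hsub)
  have hvol : volume (Metric.ball x (γ * c * h i)) = ((a * (h i).toNNReal) ^ 3 * b : NNReal) := by
    rw [Measure.addHaar_ball _ _ (by have := hh i; positivity), hb]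
    simp only [finrank_euclideanSpace, Fintype.card_fin]
    rw [ENNReal.coe_mul, ha, ← Real.toNNReal_mul (by positivity),
      ENNReal.ofReal_pow (by have := hh i; positivity)]
    rfl
  rw [hvol, dirichletEnergy_eq_coe (hT i) hv, enorm_eq_nnnorm] at hE
  norm_cast at hE
  have hK : ‖LinearMap.toContinuousLinearMap f.linear‖₊ ≤
      NNReal.sqrt (1 / (a ^ 3 * b) * (dirichletEnergy v).toNNReal / (h i).toNNReal ^ 3) := by
    rw [NNReal.le_sqrt_iff_sq_le, one_div_mul_eq_div, div_div, le_div_iff₀ (by positivity)]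
    refine le_of_eq_of_le ?_ hE
    ring
  intro y hy w hw
  rw [hf hy, hf hw]
  exact f.lipschitzWith_linear.weaken hK y w

/-- Discrete Sobolev inequality. -/
theorem exists_sq_le_dirichletEnergy_div {ι : Type*} {T : ι → Geometry.SimplicialComplex ℝ R3}
    {h : ι → ℝ} (hh : ∀ i, 0 < h i) (hT : ∀ i, IsTriangulation (T i))
    (hshape : IsShapeRegularFamily T) (hquasi : IsQuasiUniformFamily T h) :
    ∃ C : NNReal, ∀ i, ∀ v ∈ femSpaceZero (T i), ∀ z,
      ‖v z‖₊ ^ 2 ≤ C * (dirichletEnergy v).toNNReal / (h i).toNNReal := by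
  obtain ⟨A, hA⟩ := exists_lipschitzWith_sq_le hh hT hshape hquasi
  obtain ⟨C, hC⟩ := exists_enorm_pow_three_le_of_lipschitz
  obtain ⟨D, hD⟩ : ∃ D : NNReal, D ^ 3 = C ^ 2 * A := by
    refine ⟨(C ^ 2 * A) ^ (3⁻¹ : ℝ), ?_⟩
    rw [← NNReal.rpow_natCast, ← NNReal.rpow_mul]
    norm_num
  refine ⟨D, fun i v hv z => ?_⟩
  obtain ⟨K, hK, hKA⟩ := hA i v hv
  have h3 := hC v K (hasCompactSupport_of_mem_femSpaceZero (hT i) hv) hK z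
  rw [dirichletEnergy_eq_coe (hT i) hv, enorm_eq_nnnorm] at h3
  norm_cast at h3
  set E := (dirichletEnergy v).toNNReal
  refine (pow_le_pow_iff_left₀ (zero_le) (zero_le) (three_ne_zero)).1 ?_
  calc (‖v z‖₊ ^ 2) ^ 3 = (‖v z‖₊ ^ 3) ^ 2 := by ring
    _ ≤ (C * K * E) ^ 2 := by gcongr
    _ = (C ^ 2 * A) * E ^ 3 / (h i).toNNReal ^ 3 := by
        rw [mul_pow, mul_pow, hKA]; ring
    _ = (D * E / (h i).toNNReal) ^ 3 := by rw [← hD]; ring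

/-! ### Interpolation and conclusion -/

/-- For finite `q`, integrate `|g|^q ≤ (sup |g|)^(q-2) |g|²`: the powers of `h` add up to `-2(q-2) -
1 = 3 - 2q`, those of `B` to `q`, so the constant does not depend on `q`. -/
theorem eLpNorm_le_of_bound_of_lintegral_sq {α F : Type*} [MeasurableSpace α] {μ : Measure α}
    [NormedAddCommGroup F] {g : α → F} {B h : ℝ} (hB : 0 < B) (hh : 0 < h)
    (hsup : ∀ x, ‖g x‖ ≤ B * h ^ (-2 : ℝ))
    (hsq : ∫⁻ x, ‖g x‖ₑ ^ 2 ∂μ ≤ ENNReal.ofReal (B ^ (2 : ℝ) * h ^ (-1 : ℝ))) {p : ℝ≥0∞}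
    (hp : 2 ≤ p) :
    eLpNorm g p μ ≤ ENNReal.ofReal (B * h ^ (3 * (p⁻¹).toReal - 2)) := by
  have hsup' : ∀ x, ‖g x‖ₑ ≤ ENNReal.ofReal (B * h ^ (-2 : ℝ)) := fun x => by
    rw [← ofReal_norm]; exact ENNReal.ofReal_le_ofReal (hsup x)
  rcases eq_or_ne p ⊤ with rfl | hpt
  · rw [eLpNorm_exponent_top]
    simpa [eLpNormEssSup] using essSup_le_of_ae_le _ (Filter.Eventually.of_forall hsup')
  have hp0 : p ≠ 0 := (zero_lt_two.trans_le hp).ne'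
  have hq : 2 ≤ p.toReal := by simpa using ENNReal.toReal_mono hpt hp
  rw [eLpNorm_eq_lintegral_rpow_enorm_toReal hp0 hpt, ENNReal.toReal_inv]
  set q := p.toReal
  have hq0 : 0 < q := by linarith
  have key : ∫⁻ x, ‖g x‖ₑ ^ q ∂μ ≤ ENNReal.ofReal ((B * h ^ (3 * q⁻¹ - 2)) ^ q) := by
    calc ∫⁻ x, ‖g x‖ₑ ^ q ∂μ
        ≤ ∫⁻ x, ENNReal.ofReal (B * h ^ (-2 : ℝ)) ^ (q - 2) * ‖g x‖ₑ ^ 2 ∂μ := by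
          refine lintegral_mono fun x => ?_
          have : ‖g x‖ₑ ^ q = ‖g x‖ₑ ^ (q - 2) * ‖g x‖ₑ ^ 2 := by
            rw [← ENNReal.rpow_natCast, ← ENNReal.rpow_add_of_nonneg _ _ (by linarith) (by norm_num)]
            norm_num
          rw [this]
          gcongr
          exact hsup' x
      _ = ENNReal.ofReal (B * h ^ (-2 : ℝ)) ^ (q - 2) * ∫⁻ x, ‖g x‖ₑ ^ 2 ∂μ :=
          lintegral_const_mul' _ _
            (ENNReal.rpow_ne_top_of_nonneg (by linarith) ENNReal.ofReal_ne_top)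
      _ ≤ ENNReal.ofReal (B * h ^ (-2 : ℝ)) ^ (q - 2) *
            ENNReal.ofReal (B ^ (2 : ℝ) * h ^ (-1 : ℝ)) := by gcongr
      _ = ENNReal.ofReal ((B * h ^ (3 * q⁻¹ - 2)) ^ q) := by
          rw [ENNReal.ofReal_rpow_of_nonneg (by positivity) (by linarith),
            ← ENNReal.ofReal_mul (by positivity), Real.mul_rpow hB.le (by positivity),
            Real.mul_rpow hB.le (by positivity), ← Real.rpow_mul hh.le, ← Real.rpow_mul hh.le,
            mul_mul_mul_comm, ← Real.rpow_add hB, ← Real.rpow_add hh]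
          congr 3
          · ring
          · field_simp; ring
  refine (ENNReal.rpow_le_rpow key (by positivity)).trans_eq ?_
  rw [ENNReal.ofReal_rpow_of_nonneg (by positivity) (by positivity), ← Real.rpow_mul (by positivity),
    mul_one_div_cancel hq0.ne', Real.rpow_one]

theorem mainTheorem10 {ι : Type*} (Ω : Set R3) (hΩ_open : IsOpen Ω) (hΩ_convex : Convex ℝ Ω)
    (hΩ_bounded : Bornology.IsBounded Ω)
    (T : ι → Geometry.SimplicialComplex ℝ R3) (h : ι → ℝ)
    (hh : ∀ i, 0 < h i ∧ h i < 1)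
    (hT : ∀ i, IsTriangulation (T i))
    (hTΩ : ∀ i, meshDomain (T i) ⊆ Ω)
    (hshape : IsShapeRegularFamily T)
    (hquasi : IsQuasiUniformFamily T h) :
    (∀ i, ∀ z ∈ Ω, ∃! G : R3 → ℝ, IsDiscreteGreen (T i) z G) ∧
    ∃ C : ℝ, 0 < C ∧ ∀ i, ∀ z ∈ Ω, ∀ G : R3 → ℝ, IsDiscreteGreen (T i) z G →
      ∀ p : ℝ≥0∞, 2 ≤ p →
        eLpNorm (∇ G) p (volume.restrict (meshDomain (T i))) ≤
          ENNReal.ofReal (C * h i ^ (3 * (p⁻¹).toReal - 2)) := by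
  refine ⟨fun i z _ => existsUnique_isDiscreteGreen (hT i) z, ?_⟩
  obtain ⟨A, hA⟩ := exists_lipschitzWith_sq_le (fun i => (hh i).1) hT hshape hquasi
  obtain ⟨D, hD⟩ := exists_sq_le_dirichletEnergy_div (fun i => (hh i).1) hT hshape hquasi
  -- The endpoint bounds need `D ≤ B²` and `A D ≤ B²`; the summand `1` gives `B ≤ B²` and avoids
  -- square roots.
  set B : NNReal := 1 + D + A * D with hBdef
  have hB1 : 1 ≤ B := by rw [hBdef, add_assoc]; exact le_self_add
  have hBsq : B ≤ B ^ 2 := by rw [sq]; exact le_mul_of_one_le_left zero_le hB1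
  have hDB : D ≤ B ^ 2 :=
    (le_add_self.trans (le_self_add (a := 1 + D) (b := A * D))).trans hBsq
  have hADB : A * D ≤ B ^ 2 := (le_add_self (a := A * D) (b := 1 + D)).trans hBsq
  refine ⟨B, by positivity, fun i z _ G hG p hp => ?_⟩
  have hh0 : 0 < (h i).toNNReal := Real.toNNReal_pos.2 (hh i).1
  have hhc : ((h i).toNNReal : ℝ) = h i := Real.coe_toNNReal _ (hh i).1.le
  set E := (dirichletEnergy G).toNNReal with hE
  have hEz : E ≤ ‖G z‖₊ := by
    have h1 := dirichletEnergy_eq_ofReal (hT i) hG.1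
    rw [hG.2 G hG.1] at h1
    rw [hE, h1]
    exact (Real.toNNReal_le_toNNReal (le_abs_self _)).trans_eq (Real.toNNReal_abs _)
  have hEh : E ≤ D / (h i).toNNReal := by
    -- The case `E = 0` is split off so that `E` can be cancelled from `E² ≤ D E / h`.
    rcases eq_or_ne E 0 with h0 | h0
    · rw [h0]; exact zero_le
    · have h1 : E ^ 2 ≤ D * E / (h i).toNNReal := (pow_le_pow_left₀ zero_le hEz 2).trans (hD i G hG.1 z)
      refine le_of_mul_le_mul_right ?_ (pos_iff_ne_zero.2 h0)
      calc E * E = E ^ 2 := (sq E).symm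
        _ ≤ D * E / (h i).toNNReal := h1
        _ = D / (h i).toNNReal * E := by ring
  obtain ⟨K, hK, hKA⟩ := hA i G hG.1
  have hKB : K ≤ B / (h i).toNNReal ^ 2 := by
    refine (pow_le_pow_iff_left₀ zero_le zero_le two_ne_zero).1 ?_
    calc K ^ 2 = A * E / (h i).toNNReal ^ 3 := hKA
      _ ≤ A * (D / (h i).toNNReal) / (h i).toNNReal ^ 3 := by gcongr
      _ = A * D / (h i).toNNReal ^ 4 := by field_simp
      _ ≤ B ^ 2 / (h i).toNNReal ^ 4 := by gcongr
      _ = (B / (h i).toNNReal ^ 2) ^ 2 := by field_simp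
  refine eLpNorm_le_of_bound_of_lintegral_sq (by positivity) (hh i).1 (fun x => ?_) ?_ hp
  · refine (norm_gradient_le hK x).trans ?_
    rw [Real.rpow_neg (hh i).1.le, Real.rpow_two, ← div_eq_mul_inv, ← hhc]
    exact_mod_cast hKB
  · rw [← dirichletEnergy_eq_setLIntegral (hT i) hG.1, dirichletEnergy_eq_coe (hT i) hG.1,
      ← ENNReal.ofReal_coe_nnreal]
    refine ENNReal.ofReal_le_ofReal ?_
    rw [Real.rpow_neg (hh i).1.le, Real.rpow_one, Real.rpow_two, ← div_eq_mul_inv, ← hhc]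
    exact_mod_cast hEh.trans (div_le_div_of_nonneg_right hDB zero_le)
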